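/- Let $\mathcal A=\mathbb R[\lambda,u_0,u_1,u_2,\dots]$ be the algebra of differential polynomials in $u=u_0$, with $u_k=\partial_x^k u$ and polynomial dependence on a parameter $\lambda$. On $\mathcal A$ let $\partial_x=\sum_{k\ge 0}u_{k+1}\frac{\partial}{\partial u_k}$ (so $\partial_x\lambda=0$) be the total derivative, and let $$\delta f=\sum_{k\ge 0}(-1)^k\partial_x^k\frac{\partial f}{\partial u_k}$$ be the variational derivative. There is a unique sequence $(R_n)_{n\ge 0}$ in $\mathcal A$ (the Gelfand–Dickey polynomials) such that $R_0=1$, $$\partial_x R_{n+1}=\frac{1}{2n+1}\Bigl(\partial_x u\cdot R_n+2u\cdot\partial_x R_n+\frac{\lambda^2}{4}\partial_x^3R_n\Bigr)\qquad(n\ge 0),$$ and, for all $n\ge 1$, $R_n$ vanishes when all $u_k$ are set to $0$. For every $n\ge 0$ there is a $T_n\in\mathcal A$ with $\partial_xT_n=\partial_xu\cdot R_n$, and every such $T_n$ satisfies $$\delta T_n=\Bigl(1-\lambda\frac{\partial}{\partial\lambda}\Bigr)R_n.$$ -/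

import Mathlib

noncomputable section

namespace GelfandDickey

open MvPolynomial

/-- The algebra `ℝ[λ, u₀, u₁, u₂, …]` of differential polynomials in a field `u`, with polynomial
dependence on the parameter `λ`.  The index `none` is the parameter `λ`, the index `some k` is the
jet variable `u_k = ∂ₓᵏ u`. -/
abbrev DiffPoly : Type := MvPolynomial (Option ℕ) ℝ

/-- The parameter `λ`. -/
def lam : DiffPoly := X none

/-- The jet variable `u_k = ∂ₓᵏ u`; in particular `jet 0 = u` and `jet 1 = ∂ₓ u`. -/
def jet (k : ℕ) : DiffPoly := X (some k)

/-- The total derivative `∂ₓ = ∑ₖ u_{k+1} ∂/∂u_k`: the `ℝ`-linear derivation with `∂ₓ λ = 0` and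
`∂ₓ u_k = u_{k+1}`. -/
def dx : Derivation ℝ DiffPoly DiffPoly :=
  mkDerivation ℝ (fun i : Option ℕ => i.elim 0 (fun k => jet (k + 1)))

/-- The Euler operator `λ ∂/∂λ`. -/
def lamDlam (f : DiffPoly) : DiffPoly := lam * pderiv none f

/-- The variational derivative `δ f = ∑ₖ (-1)ᵏ ∂ₓᵏ (∂f/∂u_k)`.  Only finitely many terms are
nonzero, see `finite_support_varDeriv`. -/
def varDeriv (f : DiffPoly) : DiffPoly :=
  ∑ᶠ k : ℕ, (-1) ^ k * dx^[k] (pderiv (some k) f)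

/-- The sum which defines the variational derivative is finite. -/
theorem finite_support_varDeriv (f : DiffPoly) :
    (Function.support fun k : ℕ => (-1) ^ k * dx^[k] (pderiv (some k) f)).Finite := by
  have h : ((fun k : ℕ => some k) ⁻¹' (f.vars : Set (Option ℕ))).Finite :=
    f.vars.finite_toSet.preimage (Option.some_injective ℕ).injOn
  refine h.subset fun k hk => ?_
  by_contra hv
  apply hk
  have h0 : pderiv (some k) f = 0 := pderiv_eq_zero_of_notMem_vars hv
  simp [h0, iterate_map_zero]

/-- The term of `f` which is free of `u`, a polynomial in `λ`: set `u_k = 0` for all `k`. -/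
def atZeroField : DiffPoly →ₐ[ℝ] DiffPoly :=
  aeval (fun i : Option ℕ => i.elim lam (fun _ => 0))

/-- `R` is the sequence of Gelfand–Dickey polynomials: it satisfies the Lenard recursion, and the
constant of integration in each step of the recursion is zero. -/
structure IsGelfandDickey (R : ℕ → DiffPoly) : Prop where
  zero : R 0 = 1
  lenard : ∀ n : ℕ, dx (R (n + 1)) =
    C (1 / (2 * (n : ℝ) + 1)) *
      (dx (jet 0) * R n + 2 * jet 0 * dx (R n) + C (1 / 4) * lam ^ 2 * dx (dx (dx (R n))))
  normalized : ∀ n : ℕ, atZeroField (R (n + 1)) = 0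

end GelfandDickey

end

noncomputable section

open MvPolynomial

/-! Let r_n = (2n-1)!! R_n, S = ∑ r_n Zⁿ, a = λ²/4, and write ' for ∂ₓ. The source of everything is
S² - Z(2uS² + a(2SS'' - S'²)) = 1, which determines S recursively without any integration. Its
linearization along a derivation commuting with ∂ₓ has the operator L(y) = S(1 - 2Zu)y - Za(yS'' +
Sy'' - S'y') on the left. Along ∂ₓ it becomes the Lenard recursion, whence existence. Along the
variation u ↦ v, with F the variation of S, it reads L(F) = ZvS². Along λ∂/∂λ, with E = λ∂S/∂λ, it
gives L(S+E) = (1 - 2Zu)S². A Lagrange identity for L then makes (S+E)Zv - F(1 - 2Zu) a total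
derivative, so the variation of a potential of u₁r_n is v(r_n - λ∂r_n/∂λ) modulo total derivatives.
It is also v times the variational derivative, and v is arbitrary. Uniqueness of R_n and
independence of the choice of T_n hold because ker ∂ₓ consists of the polynomials in λ. -/

/-- The coefficientwise extension of a derivation of `A` to formal power series over `A`. -/
def PowerSeries.coeffDerivation {K A : Type*} [CommRing K] [CommRing A] [Algebra K A]
    (D : Derivation K A A) : Derivation K (PowerSeries A) (PowerSeries A) :=
  Derivation.mk'
    { toFun := fun f => PowerSeries.mk fun n => D (PowerSeries.coeff n f)
      map_add' := fun f g => by ext n; simp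
      map_smul' := fun c f => by ext n; simp }
    fun f g => by
      ext n
      simp [PowerSeries.coeff_mul, Finset.sum_add_distrib]
      rw [← Finset.Nat.sum_antidiagonal_swap]
      simp

theorem PowerSeries.coeff_coeffDerivation {K A : Type*} [CommRing K] [CommRing A] [Algebra K A]
    (D : Derivation K A A) (f : PowerSeries A) (n : ℕ) :
    PowerSeries.coeff n (PowerSeries.coeffDerivation D f) = D (PowerSeries.coeff n f) := by
  simp [PowerSeries.coeffDerivation]

theorem PowerSeries.coeffDerivation_C {K A : Type*} [CommRing K] [CommRing A] [Algebra K A]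
    (D : Derivation K A A) (a : A) :
    PowerSeries.coeffDerivation D (PowerSeries.C a) = PowerSeries.C (D a) := by
  ext n
  rw [PowerSeries.coeff_coeffDerivation, PowerSeries.coeff_C, PowerSeries.coeff_C]
  split_ifs <;> simp

theorem PowerSeries.coeffDerivation_X {K A : Type*} [CommRing K] [CommRing A] [Algebra K A]
    (D : Derivation K A A) :
    PowerSeries.coeffDerivation D (PowerSeries.X : PowerSeries A) = 0 := by
  ext n
  rw [PowerSeries.coeff_coeffDerivation, PowerSeries.coeff_X]
  split_ifs <;> simp

theorem PowerSeries.coeffDerivation_comm {K A : Type*} [CommRing K] [CommRing A] [Algebra K A]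
    {D E : Derivation K A A} (h : ∀ a, D (E a) = E (D a)) (f : PowerSeries A) :
    PowerSeries.coeffDerivation D (PowerSeries.coeffDerivation E f) =
      PowerSeries.coeffDerivation E (PowerSeries.coeffDerivation D f) := by
  ext n
  simp only [PowerSeries.coeff_coeffDerivation, h]

namespace GelfandDickey

/-! ### Order of differential polynomials and the kernel of `dx` -/

theorem dx_jet (k : ℕ) : dx (jet k) = jet (k + 1) := by
  simp [dx, jet, mkDerivation_X]

theorem dx_lam : dx lam = 0 := by
  simp [dx, lam, mkDerivation_X]

theorem derivation_two (D : Derivation ℝ DiffPoly DiffPoly) : D 2 = 0 := by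
  exact_mod_cast Derivation.map_natCast D 2

/-- Two derivations commute as soon as they commute on the generators. -/
theorem derivation_comm {D E : Derivation ℝ DiffPoly DiffPoly}
    (h : ∀ i, D (E (X i)) = E (D (X i))) (f : DiffPoly) : D (E f) = E (D f) := by
  have : ⁅D, E⁆ = 0 := MvPolynomial.derivation_ext fun i => by
    simp [Derivation.commutator_apply, h]
  have h2 := congrArg (fun F : Derivation ℝ DiffPoly DiffPoly => F f) this
  simpa [Derivation.commutator_apply, sub_eq_zero] using h2

theorem pderiv_dx_succ (k : ℕ) (f : DiffPoly) :
    pderiv (some (k + 1)) (dx f) = dx (pderiv (some (k + 1)) f) + pderiv (some k) f := by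
  have : ⁅(pderiv (some (k + 1)) : Derivation ℝ DiffPoly DiffPoly), dx⁆ = pderiv (some k) :=
    MvPolynomial.derivation_ext fun i => by
      rw [Derivation.commutator_apply]
      rcases i with _ | j
      · change pderiv _ (dx lam) - dx (pderiv _ lam) = pderiv _ lam
        rw [dx_lam]; simp [lam, pderiv_X]
      · change pderiv _ (dx (jet j)) - dx (pderiv _ (jet j)) = pderiv _ (jet j)
        rw [dx_jet]
        by_cases h : j = k <;> by_cases h' : j = k + 1 <;>
          simp [jet, pderiv_X, Pi.single_apply, h, h', eq_comm]
  have h2 := congrArg (fun F : Derivation ℝ DiffPoly DiffPoly => F f) this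
  simp only [Derivation.commutator_apply] at h2
  rw [← h2]; ring

theorem exists_forall_pderiv_eq_zero (f : DiffPoly) :
    ∃ N : ℕ, ∀ k, N ≤ k → pderiv (some k) f = 0 := by
  have h : ((fun k : ℕ => some k) ⁻¹' (f.vars : Set (Option ℕ))).Finite :=
    f.vars.finite_toSet.preimage (Option.some_injective ℕ).injOn
  obtain ⟨N, hN⟩ := h.bddAbove
  refine ⟨N + 1, fun k hk => pderiv_eq_zero_of_notMem_vars fun hv => ?_⟩
  have := hN (show k ∈ _ from hv)
  omega

/-- If `∂ₓ f` has order at most `m`, then `f` has order less than `m`. -/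
theorem pderiv_eq_zero_of_pderiv_dx_eq_zero {f : DiffPoly} {m : ℕ}
    (h : ∀ k, m < k → pderiv (some k) (dx f) = 0) : ∀ k, m ≤ k → pderiv (some k) f = 0 := by
  obtain ⟨N, hN⟩ := exists_forall_pderiv_eq_zero f
  -- Downward induction on the order, starting above every variable in `f`.
  have key : ∀ j k, m ≤ k → N ≤ k + j → pderiv (some k) f = 0 := by
    intro j
    induction j with
    | zero => exact fun k _ hk => hN k hk
    | succ j ih =>
      intro k hm hk
      have h1 := h (k + 1) (by omega)
      rwa [pderiv_dx_succ, ih (k + 1) (by omega) (by omega), map_zero, zero_add] at h1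
  exact fun k hk => key N k hk (by omega)

theorem pderiv_eq_zero_of_dx_eq_zero {f : DiffPoly} (h : dx f = 0) (k : ℕ) :
    pderiv (some k) f = 0 :=
  pderiv_eq_zero_of_pderiv_dx_eq_zero (m := 0) (fun k _ => by rw [h, map_zero]) k (Nat.zero_le k)

theorem atZeroField_eq_self_of_pderiv_eq_zero {f : DiffPoly}
    (h : ∀ k : ℕ, pderiv (some k) f = 0) : atZeroField f = f := by
  have hv : ∀ k : ℕ, some k ∉ f.vars := by
    intro k hk
    obtain ⟨m, hm, hmk⟩ := (mem_vars_iff_mem_support _).mp hk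
    have h1 : Finsupp.single (some k) 1 ≤ m := by
      rw [Finsupp.single_le_iff]
      exact Nat.one_le_iff_ne_zero.mpr (Finsupp.mem_support_iff.mp hmk)
    have h2 := congrArg (coeff (m - Finsupp.single (some k) 1)) (h k)
    rw [coeff_pderiv, tsub_add_cancel_of_le h1, coeff_zero] at h2
    rcases mul_eq_zero.mp h2 with h3 | h3
    · exact mem_support_iff.mp hm h3
    · exact absurd h3 (by positivity)
  have := hom_congr_vars (f₁ := (atZeroField : DiffPoly →+* DiffPoly)) (f₂ := RingHom.id DiffPoly)
    (p₁ := f) (p₂ := f) (by ext a; simp) (fun i hi _ => ?_) rfl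
  · exact this
  · rcases i with _ | k
    · simp [atZeroField, lam]
    · exact absurd hi (hv k)

theorem atZeroField_dx (f : DiffPoly) : atZeroField (dx f) = 0 := by
  induction f using MvPolynomial.induction_on with
  | C a => simp [dx]
  | add p q hp hq => simp [hp, hq]
  | mul_X p i hp =>
    have hi : atZeroField (dx (X i)) = 0 := by
      rcases i with _ | k
      · change atZeroField (dx lam) = 0
        rw [dx_lam, map_zero]
      · change atZeroField (dx (jet k)) = 0
        rw [dx_jet]; simp [atZeroField, jet]
    simp [hp, hi]

theorem eq_of_dx_eq {f g : DiffPoly} (h : dx f = dx g) (h0 : atZeroField f = atZeroField g) :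
    f = g := by
  have h1 : dx (f - g) = 0 := by rw [map_sub, h, sub_self]
  have h2 := atZeroField_eq_self_of_pderiv_eq_zero (pderiv_eq_zero_of_dx_eq_zero h1)
  rw [map_sub, h0, sub_self] at h2
  exact (sub_eq_zero.mp h2.symm)

theorem varDeriv_eq_of_dx_eq {f g : DiffPoly} (h : dx f = dx g) : varDeriv f = varDeriv g := by
  have h1 : dx (f - g) = 0 := by rw [map_sub, h, sub_self]
  have h2 : ∀ k : ℕ, pderiv (some k) f = pderiv (some k) g := fun k => by
    have := pderiv_eq_zero_of_dx_eq_zero h1 k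
    rwa [map_sub, sub_eq_zero] at this
  simp only [varDeriv, h2]

/-! ### Evolutionary derivations and the first variation -/

/-- The evolutionary derivation with characteristic `v`: `λ ↦ 0` and `u_k ↦ ∂ₓᵏ v`. -/
def evol (v : DiffPoly) : Derivation ℝ DiffPoly DiffPoly :=
  mkDerivation ℝ (fun i : Option ℕ => i.elim 0 (fun k => dx^[k] v))

theorem evol_jet (v : DiffPoly) (k : ℕ) : evol v (jet k) = dx^[k] v := by
  simp [evol, jet, mkDerivation_X]

theorem evol_lam (v : DiffPoly) : evol v lam = 0 := by
  simp [evol, lam, mkDerivation_X]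

theorem evol_dx (v f : DiffPoly) : evol v (dx f) = dx (evol v f) := by
  refine derivation_comm (fun i => ?_) f
  rcases i with _ | k
  · change evol v (dx lam) = dx (evol v lam)
    rw [dx_lam, evol_lam, map_zero, map_zero]
  · change evol v (dx (jet k)) = dx (evol v (jet k))
    rw [dx_jet, evol_jet, evol_jet, Function.iterate_succ_apply']

/-- The Euler operator `λ ∂/∂λ` as a derivation. -/
def eulerLam : Derivation ℝ DiffPoly DiffPoly := lam • pderiv none

theorem eulerLam_apply (f : DiffPoly) : eulerLam f = lamDlam f := rfl

theorem eulerLam_jet (k : ℕ) : eulerLam (jet k) = 0 := by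
  simp [eulerLam, jet, pderiv_X]

theorem eulerLam_lam : eulerLam lam = lam := by
  simp [eulerLam, lam, pderiv_X]

theorem eulerLam_dx (f : DiffPoly) : eulerLam (dx f) = dx (eulerLam f) := by
  refine derivation_comm (fun i => ?_) f
  rcases i with _ | k
  · change eulerLam (dx lam) = dx (eulerLam lam)
    rw [dx_lam, eulerLam_lam, dx_lam, map_zero]
  · change eulerLam (dx (jet k)) = dx (eulerLam (jet k))
    rw [dx_jet, eulerLam_jet, eulerLam_jet, map_zero]

/-- Repeated integration by parts. -/
theorem exists_dx_eq_iterate_mul_sub (v : DiffPoly) (k : ℕ) (a : DiffPoly) :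
    ∃ h, dx h = dx^[k] v * a - v * ((-1) ^ k * dx^[k] a) := by
  induction k generalizing a with
  | zero => exact ⟨0, by simp⟩
  | succ k ih =>
    obtain ⟨h, hh⟩ := ih (dx a)
    refine ⟨dx^[k] v * a - h, ?_⟩
    rw [map_sub, hh, Derivation.leibniz, Function.iterate_succ_apply', Function.iterate_succ_apply]
    simp only [smul_eq_mul]
    ring

theorem evol_eq_sum (v f : DiffPoly) {N : ℕ} (hN : ∀ k, N ≤ k → (some k) ∉ f.vars) :
    evol v f = ∑ k ∈ Finset.range N, dx^[k] v * pderiv (some k) f := by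
  have h : evol v f = (∑ k ∈ Finset.range N,
      dx^[k] v • (pderiv (some k) : Derivation ℝ DiffPoly DiffPoly)) f := by
    refine derivation_eq_of_forall_mem_vars fun i hi => ?_
    rw [← Derivation.coeFnAddMonoidHom_apply (∑ k ∈ _, _), map_sum, Finset.sum_apply]
    simp only [Derivation.coeFnAddMonoidHom_apply]
    rcases i with _ | j
    · change evol v lam = _
      rw [evol_lam]
      simp
    · have hj : j < N := by
        by_contra hj
        exact hN j (by omega) hi
      change evol v (jet j) = _
      rw [evol_jet, Finset.sum_eq_single_of_mem j (Finset.mem_range.mpr hj)]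
      · simp
      · intro k _ hk
        simp [pderiv_X, Ne.symm hk]
  rw [h, ← Derivation.coeFnAddMonoidHom_apply, map_sum, Finset.sum_apply]
  rfl

/-- The first variation formula: `evol v f` equals `v * varDeriv f` up to a total derivative. -/
theorem exists_dx_eq_evol_sub (v f : DiffPoly) : ∃ h, dx h = evol v f - v * varDeriv f := by
  have hfin : ((fun k : ℕ => some k) ⁻¹' (f.vars : Set (Option ℕ))).Finite :=
    f.vars.finite_toSet.preimage (Option.some_injective ℕ).injOn
  obtain ⟨N, hN⟩ := hfin.bddAbove
  have hv : ∀ k, N + 1 ≤ k → (some k) ∉ f.vars := fun k hk hv => by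
    have := hN (show k ∈ _ from hv)
    omega
  have hvar : varDeriv f =
      ∑ k ∈ Finset.range (N + 1), (-1) ^ k * dx^[k] (pderiv (some k) f) := by
    refine finsum_eq_sum_of_support_subset _ fun k hk => ?_
    rw [Finset.coe_range, Set.mem_Iio]
    by_contra hk'
    apply hk
    simp [pderiv_eq_zero_of_notMem_vars (hv k (by omega)), iterate_map_zero]
  choose h hh using fun k => exists_dx_eq_iterate_mul_sub v k (pderiv (some k) f)
  refine ⟨∑ k ∈ Finset.range (N + 1), h k, ?_⟩
  rw [map_sum, evol_eq_sum v f hv, hvar, Finset.mul_sum, ← Finset.sum_sub_distrib]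
  exact Finset.sum_congr rfl fun k _ => hh k

/-- A polynomial all of whose multiples are total derivatives vanishes. -/
theorem eq_zero_of_forall_mul_mem_range {g : DiffPoly} (hg : ∀ v, ∃ h, dx h = v * g) : g = 0 := by
  obtain ⟨N, hN⟩ := exists_forall_pderiv_eq_zero g
  -- If `h` has order at most N, then `dx h` is affine in the jet variable of index N + 1, whereas
  -- this multiple of `g` is quadratic in it.
  obtain ⟨h, hh⟩ := hg (jet (N + 1) ^ 2)
  have h1 : ∀ k, N + 1 ≤ k → pderiv (some k) h = 0 := by
    refine pderiv_eq_zero_of_pderiv_dx_eq_zero fun k hk => ?_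
    rw [hh, Derivation.leibniz, hN k (by omega), Derivation.leibniz_pow]
    have : (pderiv (some k) : Derivation ℝ DiffPoly DiffPoly) (jet (N + 1)) = 0 :=
      pderiv_X_of_ne (by simp; omega)
    simp [this]
  have hj : (pderiv (some (N + 1)) : Derivation ℝ DiffPoly DiffPoly) (jet (N + 1)) = 1 :=
    pderiv_X_self _
  have h2 : pderiv (some N) h = 2 * jet (N + 1) * g := by
    have := pderiv_dx_succ N h
    rw [h1 (N + 1) le_rfl, map_zero, zero_add, hh, Derivation.leibniz, hN (N + 1) (by omega),
      Derivation.leibniz_pow, hj] at this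
    rw [← this]
    simp
    ring
  have h3 : pderiv (some (N + 1)) (pderiv (some N) h) = 0 := by
    rw [derivation_comm (fun i => ?_) h, h1 (N + 1) le_rfl, map_zero]
    simp [pderiv_X, Pi.single_apply]
    split_ifs <;> simp
  rw [h2, Derivation.leibniz, hN (N + 1) (by omega), Derivation.leibniz, hj, derivation_two] at h3
  simpa using h3

/-! ### The resolvent series and its quadratic identity -/

/-- `λ² / 4` -/
def quarterLamSq : DiffPoly := C (1 / 4) * lam ^ 2

theorem dx_quarterLamSq : dx quarterLamSq = 0 := by
  rw [quarterLamSq, Derivation.leibniz, Derivation.leibniz_pow, dx_lam]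
  simp [dx]

theorem evol_quarterLamSq (v : DiffPoly) : evol v quarterLamSq = 0 := by
  rw [quarterLamSq, Derivation.leibniz, Derivation.leibniz_pow, evol_lam]
  simp [evol]

theorem eulerLam_quarterLamSq : eulerLam quarterLamSq = 2 * quarterLamSq := by
  rw [quarterLamSq, Derivation.leibniz, Derivation.leibniz_pow, eulerLam_lam]
  simp [eulerLam]
  ring

/-- The coefficients of the diagonal resolvent, i.e. `(2n - 1)!!` times the Gelfand–Dickey
polynomials. -/
def resolventCoeff : ℕ → DiffPoly
  | 0 => 1
  | n + 1 => C (1 / 2) *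
      (2 * jet 0 * ∑ i : Fin (n + 1), resolventCoeff i * resolventCoeff (n - i) +
        quarterLamSq * ∑ i : Fin (n + 1), (2 * resolventCoeff i * dx (dx (resolventCoeff (n - i))) -
          dx (resolventCoeff i) * dx (resolventCoeff (n - i))) -
        ∑ i : Fin n, resolventCoeff (i + 1) * resolventCoeff (n - i))
  decreasing_by all_goals omega

/-- The generating series of `resolventCoeff`. -/
def resolvent : PowerSeries DiffPoly := PowerSeries.mk resolventCoeff

local notation "∂" => PowerSeries.coeffDerivation dx

theorem coeff_resolvent (n : ℕ) : PowerSeries.coeff n resolvent = resolventCoeff n :=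
  PowerSeries.coeff_mk _ _

theorem coeff_mul_eq_sum_fin (f g : PowerSeries DiffPoly) (n : ℕ) :
    PowerSeries.coeff n (f * g) =
      ∑ i : Fin (n + 1), PowerSeries.coeff i f * PowerSeries.coeff (n - i) g := by
  rw [PowerSeries.coeff_mul, Finset.Nat.sum_antidiagonal_eq_sum_range_succ
    (fun i j => PowerSeries.coeff i f * PowerSeries.coeff j g), Finset.sum_range]

/-- The recursion defining `resolventCoeff` is this identity at degree n + 1, solved for the top
coefficient, which occurs as twice itself since the constant term is 1. -/
theorem resolvent_quadratic :
    resolvent ^ 2 - PowerSeries.X * (PowerSeries.C (2 * jet 0) * resolvent ^ 2 +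
      PowerSeries.C quarterLamSq * (2 * (resolvent * ∂ (∂ resolvent)) - (∂ resolvent) ^ 2)) = 1 := by
  ext1 n
  have h0 : resolventCoeff 0 = 1 := by rw [resolventCoeff]
  rcases n with _ | n
  · rw [map_sub, PowerSeries.coeff_zero_X_mul, pow_two, PowerSeries.coeff_mul]
    simp [coeff_resolvent, h0, -PowerSeries.coeff_zero_eq_constantCoeff]
  · have hS : PowerSeries.coeff (n + 1) (resolvent ^ 2) = 2 * resolventCoeff (n + 1) +
        ∑ i : Fin n, resolventCoeff (i + 1) * resolventCoeff (n - i) := by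
      rw [pow_two, coeff_mul_eq_sum_fin, Fin.sum_univ_succ, Fin.sum_univ_castSucc]
      simp [coeff_resolvent, h0]
      ring
    have hrec := resolventCoeff.eq_2 n
    have hhalf : (2 : DiffPoly) * C (1 / 2) = 1 := by
      rw [← C_1, ← map_ofNat C 2, ← map_mul]; norm_num
    rw [map_sub, PowerSeries.coeff_succ_X_mul, hS, map_add, PowerSeries.coeff_C_mul,
      PowerSeries.coeff_C_mul, pow_two, pow_two, map_sub, two_mul (resolvent * _), map_add,
      coeff_mul_eq_sum_fin, coeff_mul_eq_sum_fin, coeff_mul_eq_sum_fin]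
    simp only [PowerSeries.coeff_coeffDerivation, coeff_resolvent]
    rw [PowerSeries.coeff_one, if_neg (Nat.succ_ne_zero n)]
    simp only [Finset.sum_sub_distrib, mul_assoc, ← Finset.mul_sum] at hrec
    linear_combination 2 * hrec + (2 * (jet 0 *
      ∑ i : Fin (n + 1), resolventCoeff i * resolventCoeff (n - i)) + quarterLamSq *
      (2 * ∑ i : Fin (n + 1), resolventCoeff i * dx (dx (resolventCoeff (n - i))) -
        ∑ i : Fin (n + 1), dx (resolventCoeff i) * dx (resolventCoeff (n - i))) -
        ∑ i : Fin n, resolventCoeff (i + 1) * resolventCoeff (n - i)) * hhalf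

theorem resolvent_ne_zero : resolvent ≠ 0 := by
  intro h
  have := congrArg (PowerSeries.coeff 0) h
  rw [coeff_resolvent, resolventCoeff] at this
  simp at this

theorem powerSeries_two_ne_zero : (2 : PowerSeries DiffPoly) ≠ 0 := by
  intro h
  have := congrArg (PowerSeries.coeff 0) h
  rw [← map_ofNat PowerSeries.C 2, PowerSeries.coeff_zero_C, map_zero] at this
  exact two_ne_zero this

theorem coeffDerivation_two (D : Derivation ℝ DiffPoly DiffPoly) :
    PowerSeries.coeffDerivation D 2 = 0 := by
  exact_mod_cast Derivation.map_natCast _ 2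

/-- The linearization of the quadratic identity of the resolvent. -/
theorem coeffDerivation_resolvent {D : Derivation ℝ DiffPoly DiffPoly}
    (hD : ∀ f, D (dx f) = dx (D f)) {b c : DiffPoly} (hb : D (jet 0) = b)
    (hc : D quarterLamSq = 2 * c) :
    let F := PowerSeries.coeffDerivation D resolvent
    resolvent * (1 - 2 * PowerSeries.X * PowerSeries.C (jet 0)) * F -
      PowerSeries.X * PowerSeries.C quarterLamSq *
        (F * ∂ (∂ resolvent) + resolvent * ∂ (∂ F) - ∂ resolvent * ∂ F) =
    PowerSeries.X * (PowerSeries.C b * resolvent ^ 2 +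
      PowerSeries.C c * (2 * (resolvent * ∂ (∂ resolvent)) - (∂ resolvent) ^ 2)) := by
  intro F
  have h := congrArg (PowerSeries.coeffDerivation D) resolvent_quadratic
  simp only [map_sub, map_add, Derivation.leibniz, Derivation.leibniz_pow,
    PowerSeries.coeffDerivation_X, PowerSeries.coeffDerivation_C, coeffDerivation_two,
    PowerSeries.coeffDerivation_comm hD, hb, hc, Derivation.map_one_eq_zero, map_mul, map_ofNat,
    smul_eq_mul, nsmul_eq_mul, mul_zero, add_zero, Nat.add_one_sub_one, pow_one] at h
  refine mul_left_cancel₀ powerSeries_two_ne_zero ?_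
  push_cast at h
  linear_combination h

theorem dx_resolvent :
    ∂ resolvent = PowerSeries.X * (PowerSeries.C (jet 1) * resolvent +
      2 * PowerSeries.C (jet 0) * ∂ resolvent +
      PowerSeries.C quarterLamSq * ∂ (∂ (∂ resolvent))) := by
  have h := coeffDerivation_resolvent (D := dx) (fun _ => rfl) (dx_jet 0)
    (c := 0) (by rw [dx_quarterLamSq, mul_zero])
  -- For D = ∂ₓ the terms S'S'' cancel, and everything left is divisible by S.
  refine mul_left_cancel₀ resolvent_ne_zero ?_
  simp only [map_zero, zero_add] at h
  linear_combination h

theorem dx_resolventCoeff_succ (n : ℕ) :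
    dx (resolventCoeff (n + 1)) = jet 1 * resolventCoeff n + 2 * jet 0 * dx (resolventCoeff n) +
      quarterLamSq * dx (dx (dx (resolventCoeff n))) := by
  have h := congrArg (PowerSeries.coeff (n + 1)) dx_resolvent
  rw [PowerSeries.coeff_succ_X_mul, map_add, map_add, ← map_ofNat PowerSeries.C 2, ← map_mul,
    PowerSeries.coeff_C_mul, PowerSeries.coeff_C_mul, PowerSeries.coeff_C_mul] at h
  simpa only [PowerSeries.coeff_coeffDerivation, coeff_resolvent] using h

theorem atZeroField_resolventCoeff (n : ℕ) : atZeroField (resolventCoeff (n + 1)) = 0 := by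
  set s := PowerSeries.map (atZeroField : DiffPoly →+* DiffPoly) resolvent with hs
  have hd : PowerSeries.map (atZeroField : DiffPoly →+* DiffPoly) (∂ resolvent) = 0 := by
    ext1 k
    simp [PowerSeries.coeff_coeffDerivation, atZeroField_dx]
  have hj : (atZeroField : DiffPoly →+* DiffPoly) (jet 0) = 0 := by
    simp [atZeroField, jet]
  have hd2 : PowerSeries.map (atZeroField : DiffPoly →+* DiffPoly) (∂ (∂ resolvent)) = 0 := by
    ext1 k
    simp [PowerSeries.coeff_coeffDerivation, atZeroField_dx]
  have h := congrArg (PowerSeries.map (atZeroField : DiffPoly →+* DiffPoly)) resolvent_quadratic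
  simp only [map_sub, map_add, map_mul, map_pow, PowerSeries.map_C, hj, hd, hd2, map_one,
    map_zero, mul_zero, zero_mul, ← hs] at h
  -- At u = 0 the quadratic identity collapses to s² = 1; the constant term selects s = 1.
  have h1 : (s - 1) * (s + 1) = 0 := by linear_combination h
  have h2 : s = 1 := by
    rcases mul_eq_zero.mp h1 with h2 | h2
    · exact sub_eq_zero.mp h2
    · have := congrArg (PowerSeries.coeff 0) h2
      rw [map_add, hs, PowerSeries.coeff_map, coeff_resolvent, resolventCoeff] at this
      norm_num at this
  have h3 := congrArg (PowerSeries.coeff (n + 1)) h2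
  rw [hs, PowerSeries.coeff_map, coeff_resolvent, PowerSeries.coeff_one,
    if_neg (Nat.succ_ne_zero n)] at h3
  exact h3

/-! ### Variation of the potentials -/

/-- A potential of `∂ₓ u` times a coefficient of the resolvent. -/
def resolventPotential (n : ℕ) : DiffPoly :=
  2 * jet 0 * resolventCoeff n + quarterLamSq * dx (dx (resolventCoeff n)) - resolventCoeff (n + 1)

theorem dx_resolventPotential (n : ℕ) :
    dx (resolventPotential n) = jet 1 * resolventCoeff n := by
  rw [resolventPotential, map_sub, map_add, dx_resolventCoeff_succ]
  simp only [Derivation.leibniz, derivation_two, dx_jet, dx_quarterLamSq, smul_eq_mul]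
  ring

theorem exists_dx_eq_evol_resolventPotential_sub (v : DiffPoly) (n : ℕ) :
    ∃ h, dx h = evol v (resolventPotential n) -
      v * (resolventCoeff n - lamDlam (resolventCoeff n)) := by
  have hF := coeffDerivation_resolvent (evol_dx v) (evol_jet v 0) (c := 0)
    (by rw [evol_quarterLamSq, mul_zero])
  have hE := coeffDerivation_resolvent eulerLam_dx (eulerLam_jet 0) eulerLam_quarterLamSq
  set S := resolvent with hS
  set F := PowerSeries.coeffDerivation (evol v) S with hFdef
  set E := PowerSeries.coeffDerivation eulerLam S with hEdef
  set Z : PowerSeries DiffPoly := PowerSeries.X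
  set a := PowerSeries.C quarterLamSq
  set u := PowerSeries.C (jet 0)
  obtain ⟨J, hJ⟩ : ∃ J, S * J = 1 :=
    ⟨_, PowerSeries.mul_invOfUnit S 1 (by
      rw [← PowerSeries.coeff_zero_eq_constantCoeff_apply, hS, coeff_resolvent, resolventCoeff]
      rfl)⟩
  have hdJ : ∂ J = - (J ^ 2 * ∂ S) := by
    have h := congrArg ∂ hJ
    rw [Derivation.leibniz, Derivation.map_one_eq_zero, smul_eq_mul, smul_eq_mul] at h
    linear_combination J * h - ∂ J * hJ
  have hda : ∂ a = 0 := by rw [PowerSeries.coeffDerivation_C, dx_quarterLamSq, map_zero]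
  have hdZ : ∂ Z = 0 := PowerSeries.coeffDerivation_X _
  simp only [Function.iterate_zero, id, map_zero, zero_mul, add_zero, zero_add] at hF hE
  set V := PowerSeries.C v
  -- Lagrange identity: with Y = S + E and W = FY' - YF', one has Y L(F) - F L(Y) = Za(SW' - S'W) =
  -- Za S²(W/S)'. Multiplying by J² = S⁻² gives the claim.
  have hmain : ∂ (Z * a * ((F * ∂ (S + E) - (S + E) * ∂ F) * J)) =
      (S + E) * Z * V - F * (1 - 2 * Z * u) := by
    simp only [map_sub, map_add, Derivation.leibniz, hda, hdZ, hdJ, smul_eq_mul]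
    linear_combination J ^ 2 * ((S + E) * hF - F * hE) +
      ((S + E) * Z * V - F * (1 - 2 * Z * u)) * (S * J + 1) * hJ -
      Z * a * (F * (∂ (∂ S) + ∂ (∂ E)) - (S + E) * ∂ (∂ F)) * J * hJ
  -- The extra ZaF' supplies the term aF'' in the variation of the potential.
  have hw : ∂ (Z * a * ((F * ∂ (S + E) - (S + E) * ∂ F) * J) + Z * a * ∂ F) =
      (Z * (2 * V * S + 2 * u * F + a * ∂ (∂ F)) - F) - Z * V * (S - E) := by
    rw [map_add, hmain]
    simp only [Derivation.leibniz, hda, hdZ, smul_eq_mul]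
    ring
  have h := congrArg (PowerSeries.coeff (n + 1)) hw
  refine ⟨_, (PowerSeries.coeff_coeffDerivation dx _ (n + 1)).symm.trans (h.trans ?_)⟩
  simp only [V, u, a, Z, mul_assoc, map_sub, map_add, PowerSeries.coeff_succ_X_mul,
    ← map_ofNat PowerSeries.C 2, PowerSeries.coeff_C_mul, hFdef, hEdef,
    PowerSeries.coeff_coeffDerivation, hS, coeff_resolvent, resolventPotential,
    Derivation.leibniz, derivation_two, evol_jet, evol_quarterLamSq, evol_dx, eulerLam_apply,
    smul_eq_mul, Function.iterate_zero, id]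
  ring

theorem varDeriv_resolventPotential (n : ℕ) :
    varDeriv (resolventPotential n) = resolventCoeff n - lamDlam (resolventCoeff n) := by
  refine sub_eq_zero.mp (eq_zero_of_forall_mul_mem_range fun v => ?_)
  obtain ⟨h, hh⟩ := exists_dx_eq_evol_resolventPotential_sub v n
  obtain ⟨k, hk⟩ := exists_dx_eq_evol_sub v (resolventPotential n)
  exact ⟨h - k, by rw [map_sub, hh, hk]; ring⟩

/-! ### Rescaling to the Gelfand–Dickey polynomials; uniqueness -/

/-- The product `1 * 3 * ⋯ * (2 * n - 1)`. -/
def oddFactorial (n : ℕ) : ℝ := ∏ i ∈ Finset.range n, (2 * (i : ℝ) + 1)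

theorem oddFactorial_succ (n : ℕ) : oddFactorial (n + 1) = oddFactorial n * (2 * (n : ℝ) + 1) :=
  Finset.prod_range_succ _ _

/-- The Gelfand–Dickey polynomials. -/
def gelfandDickey (n : ℕ) : DiffPoly := (oddFactorial n)⁻¹ • resolventCoeff n

theorem isGelfandDickey_gelfandDickey : IsGelfandDickey gelfandDickey where
  zero := by simp [gelfandDickey, oddFactorial, resolventCoeff]
  lenard n := by
    simp only [gelfandDickey, Derivation.map_smul, dx_resolventCoeff_succ, oddFactorial_succ,
      dx_jet, mul_inv, one_div]
    simp only [smul_eq_C_mul, quarterLamSq, map_mul, one_div]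
    ring
  normalized n := by
    rw [gelfandDickey, map_smul, atZeroField_resolventCoeff, smul_zero]

theorem IsGelfandDickey.unique {R R' : ℕ → DiffPoly} (hR : IsGelfandDickey R)
    (hR' : IsGelfandDickey R') : R = R' := by
  funext n
  induction n with
  | zero => rw [hR.zero, hR'.zero]
  | succ n ih =>
    exact eq_of_dx_eq (by rw [hR.lenard, hR'.lenard, ih]) (by rw [hR.normalized, hR'.normalized])

theorem varDeriv_smul (c : ℝ) (f : DiffPoly) : varDeriv (c • f) = c • varDeriv f := by
  have h : ∀ k (g : DiffPoly), dx^[k] (c • g) = c • dx^[k] g := fun k g =>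
    (Function.Commute.iterate_left (fun x => Derivation.map_smul dx c x : Function.Commute dx (c • ·)) k) g
  simp only [varDeriv, Derivation.map_smul, h, mul_smul_comm]
  exact (smul_finsum c _).symm

end GelfandDickey

end

theorem proposition2p2 :
    (∃! R : ℕ → GelfandDickey.DiffPoly, GelfandDickey.IsGelfandDickey R) ∧
    ∀ R : ℕ → GelfandDickey.DiffPoly, GelfandDickey.IsGelfandDickey R → ∀ n : ℕ,
      (∃ T : GelfandDickey.DiffPoly,
        GelfandDickey.dx T = GelfandDickey.dx (GelfandDickey.jet 0) * R n) ∧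
      ∀ T : GelfandDickey.DiffPoly,
        GelfandDickey.dx T = GelfandDickey.dx (GelfandDickey.jet 0) * R n →
          GelfandDickey.varDeriv T = R n - GelfandDickey.lamDlam (R n) := by
  refine ⟨⟨_, GelfandDickey.isGelfandDickey_gelfandDickey,
    fun _ h => h.unique GelfandDickey.isGelfandDickey_gelfandDickey⟩, fun R hR n => ?_⟩
  obtain rfl := hR.unique GelfandDickey.isGelfandDickey_gelfandDickey
  have hT : GelfandDickey.dx ((GelfandDickey.oddFactorial n)⁻¹ •
      GelfandDickey.resolventPotential n) =
      GelfandDickey.dx (GelfandDickey.jet 0) * GelfandDickey.gelfandDickey n := by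
    rw [Derivation.map_smul, GelfandDickey.dx_resolventPotential, GelfandDickey.dx_jet,
      GelfandDickey.gelfandDickey, mul_smul_comm]
  refine ⟨⟨_, hT⟩, fun T h => ?_⟩
  rw [GelfandDickey.varDeriv_eq_of_dx_eq (h.trans hT.symm), GelfandDickey.varDeriv_smul,
    GelfandDickey.varDeriv_resolventPotential, smul_sub, GelfandDickey.gelfandDickey,
    ← GelfandDickey.eulerLam_apply, ← GelfandDickey.eulerLam_apply, Derivation.map_smul]
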